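/- Let $R$ be an associative ring with identity. Write $N(R)$ for its set of nilpotent elements, $J(R)$ for its Jacobson radical and $Z(R)$ for its center. Suppose that 1. $R$ is NJ-symmetric: for all $a,b,c\in R$, if $abc\in N(R)$ then $bac\in J(R)$; 2. $R$ is left SF: every simple (unital) left $R$-module is flat; 3. $R$ is semiperiodic: for each $a\in R\setminus(J(R)\cup Z(R))$ there are positive integers $p,q$ of opposite parity with $a^q-a^p\in N(R)$. Then $R$ is a commutative (von Neumann) regular ring, that is, $ab=ba$ for all $a,b\in R$, and for each $a\in R$ there is $x\in R$ with $a=axa$. -/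

import Mathlib

open scoped TensorProduct

universe u v w w'

namespace RingNotions

section Tensor

variable (R : Type u) [Ring R]

/-- The subgroup of `N ⊗ M` (tensor product of abelian groups) generated by the elements
`n r ⊗ m - n ⊗ r m`. Here `N` is a right `R`-module (a left module over the opposite ring, so
that `n r` is written `MulOpposite.op r • n`) and `M` is a left `R`-module. -/
def balancedRelations (N : Type w) [AddCommGroup N] [Module Rᵐᵒᵖ N]
    (M : Type v) [AddCommGroup M] [Module R M] : Submodule ℤ (N ⊗[ℤ] M) :=
  Submodule.span ℤ
    {t | ∃ (n : N) (r : R) (m : M), t = (MulOpposite.op r • n) ⊗ₜ[ℤ] m - n ⊗ₜ[ℤ] (r • m)}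

/-- The tensor product over a not necessarily commutative ring `R` of a right `R`-module `N`
and a left `R`-module `M`; it is an abelian group. -/
abbrev BalancedTensor (N : Type w) [AddCommGroup N] [Module Rᵐᵒᵖ N]
    (M : Type v) [AddCommGroup M] [Module R M] : Type (max w v) :=
  (N ⊗[ℤ] M) ⧸ balancedRelations R N M

variable {R}

/-- A homomorphism of right `R`-modules respects the relations of the tensor product. -/
theorem balancedRelations_le_comap {N : Type w} [AddCommGroup N] [Module Rᵐᵒᵖ N]
    {N' : Type w'} [AddCommGroup N'] [Module Rᵐᵒᵖ N'] (f : N →ₗ[Rᵐᵒᵖ] N')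
    (M : Type v) [AddCommGroup M] [Module R M] :
    balancedRelations R N M ≤
      (balancedRelations R N' M).comap (f.toAddMonoidHom.toIntLinearMap.rTensor M) := by
  refine Submodule.span_le.2 ?_
  rintro _ ⟨n, r, m, rfl⟩
  refine Submodule.subset_span ⟨f n, r, m, ?_⟩
  simp

/-- The homomorphism `f ⊗ id` from `N ⊗_R M` to `N' ⊗_R M` induced by a homomorphism
`f : N → N'` of right `R`-modules. -/
def BalancedTensor.map {N : Type w} [AddCommGroup N] [Module Rᵐᵒᵖ N]
    {N' : Type w'} [AddCommGroup N'] [Module Rᵐᵒᵖ N'] (f : N →ₗ[Rᵐᵒᵖ] N')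
    (M : Type v) [AddCommGroup M] [Module R M] :
    BalancedTensor R N M →ₗ[ℤ] BalancedTensor R N' M :=
  (balancedRelations R N M).mapQ (balancedRelations R N' M)
    (f.toAddMonoidHom.toIntLinearMap.rTensor M) (balancedRelations_le_comap f M)

end Tensor

/-- A left `R`-module `M` is flat if `- ⊗_R M` preserves injectivity of homomorphisms of right
`R`-modules. (Right modules in the universe of `R` suffice, since already the inclusions of right
ideals into `R` detect flatness.) -/
def IsLeftFlat (R : Type u) [Ring R] (M : Type v) [AddCommGroup M] [Module R M] : Prop :=
  ∀ (N N' : Type u) [AddCommGroup N] [Module Rᵐᵒᵖ N] [AddCommGroup N'] [Module Rᵐᵒᵖ N']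
    (f : N →ₗ[Rᵐᵒᵖ] N'), Function.Injective f → Function.Injective (BalancedTensor.map f M)

/-- A ring is left SF if all its simple left modules are flat. (Every simple left `R`-module is
isomorphic to a quotient of `R`, so modules in the universe of `R` suffice.) -/
def IsLeftSF (R : Type u) [Ring R] : Prop :=
  ∀ (M : Type u) [AddCommGroup M] [Module R M], IsSimpleModule R M → IsLeftFlat R M

/-- `R` is NJ-symmetric if `abc` nilpotent implies that `bac` is in the Jacobson radical. -/
def IsNJSymmetric (R : Type u) [Ring R] : Prop :=
  ∀ a b c : R, IsNilpotent (a * b * c) → b * a * c ∈ Ring.jacobson R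

/-- `R` is semiperiodic if every `a` that is neither in the Jacobson radical nor central satisfies
that `a ^ q - a ^ p` is nilpotent for some positive integers `p`, `q` of opposite parity. -/
def IsSemiperiodic (R : Type u) [Ring R] : Prop :=
  ∀ a : R, a ∉ Ring.jacobson R → a ∉ Subring.center R →
    ∃ p q : ℕ, 0 < p ∧ 0 < q ∧ ((Even p ∧ Odd q) ∨ (Odd p ∧ Even q)) ∧
      IsNilpotent (a ^ q - a ^ p)

/-- `R` is von Neumann regular if `a ∈ aRa` for every `a`. -/
def IsVonNeumannRegular (R : Type u) [Ring R] : Prop :=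
  ∀ a : R, ∃ x : R, a = a * x * a

end RingNotions

/-!
Write `J` for the Jacobson radical of `R`. NJ-symmetry is used only to see that nilpotent elements
lie in `J`. With semiperiodicity applied to `a - 1`, it follows that `R ⧸ J` is reduced
(`IsSemiperiodic.mem_jacobson_of_sq_mem`).

Flatness of the simple module `R ⧸ M`, for a maximal left ideal `M`, says that each `a ∈ M` has the
form `a b` with `b ∈ M` (`IsLeftSF.exists_mem_eq_mul`), so that `M` does not contain the right
annihilator of `a`. In the reduced ring `R ⧸ J` annihilators are two-sided, and this makes `R ⧸ J`
von Neumann regular (`IsLeftSF.exists_sub_mem`), with all one-sided ideals two-sided. Applied to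
`a ∈ J`, the same property then gives `a = 0` (`IsLeftSF.jacobson_eq_bot`). So `J = 0` and `R` is
itself reduced and regular.

For commutativity, each maximal left ideal `M` of `R` is two-sided and `R ⧸ M` is a domain in which
every element `d` is central or satisfies `d ^ q = d ^ p` with `p`, `q` of opposite parity. Since
`J = 0`, it suffices that such a domain is commutative
(`mul_comm_of_mem_center_or_pow_eq_pow`). Noncentral elements have odd multiplicative order, and if
there are any the characteristic is two. Conjugation by a noncentral `a` then has an eigenvector
`w` with a power of `a` as eigenvalue and not commuting with `a`; but `a` and `w` generate a finite
domain, which is commutative by Wedderburn's little theorem.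
-/

namespace RingNotions

/-! ### Flat simple modules -/

section Flat

variable {R : Type u} [Ring R]

/-- Flatness of `R ⧸ M`, tested on the inclusion `aR → R`: the element `a ⊗ 1` of `aR ⊗ R ⧸ M`
vanishes in `R ⊗ R ⧸ M`, hence is zero, and its image under the multiplication map
`aR ⊗ R ⧸ M → R ⧸ aM` is the class of `a`. -/
theorem IsLeftSF.exists_mem_eq_mul (hSF : IsLeftSF R) {M : Ideal R} (hM : M.IsMaximal)
    {a : R} (ha : a ∈ M) : ∃ b ∈ M, a = a * b := by
  let N : Submodule Rᵐᵒᵖ R := Submodule.span Rᵐᵒᵖ {a}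
  let aN : N := ⟨a, Submodule.mem_span_singleton_self a⟩
  have hsimple : IsSimpleModule R (R ⧸ M) := isSimpleModule_iff_isCoatom.2 hM.out
  have hinj := hSF (R ⧸ M) hsimple N R N.subtype N.injective_subtype
  let one : R ⧸ M := Submodule.Quotient.mk 1
  have hzero : (balancedRelations R N (R ⧸ M)).mkQ (aN ⊗ₜ[ℤ] one) = 0 := by
    apply hinj
    rw [map_zero]
    have h : (1 * a) ⊗ₜ[ℤ] one - (1 : R) ⊗ₜ[ℤ] (a • one) ∈ balancedRelations R R (R ⧸ M) :=
      Submodule.subset_span ⟨(1 : R), a, one, rfl⟩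
    have h1 : a • one = 0 := by
      change (Submodule.Quotient.mk (a • (1 : R)) : R ⧸ M) = 0
      rw [Submodule.Quotient.mk_eq_zero]
      simpa using ha
    rw [h1, TensorProduct.tmul_zero, sub_zero, one_mul] at h
    exact (Submodule.Quotient.mk_eq_zero (balancedRelations R R (R ⧸ M))).2 h
  rw [Submodule.mkQ_apply, Submodule.Quotient.mk_eq_zero] at hzero
  -- `aM` is only an additive subgroup, so `R ⧸ aM` is a quotient of abelian groups.
  let aM : AddSubgroup R := M.toAddSubgroup.map (AddMonoidHom.mulLeft a)
  have hN : ∀ (n : N) (m : R), m ∈ M → (n : R) * m ∈ aM := by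
    rintro ⟨n, hn⟩ m hm
    obtain ⟨s, rfl⟩ := Submodule.mem_span_singleton.1 hn
    exact ⟨s.unop * m, M.mul_mem_left _ hm, by simp [mul_assoc]⟩
  -- The pairing `(n, x + M) ↦ n x + aM`, well defined by `hN`.
  let g : N →+ (R ⧸ M) →+ (R ⧸ aM) :=
    { toFun := fun n => QuotientAddGroup.lift M.toAddSubgroup
        ((QuotientAddGroup.mk' aM).comp (AddMonoidHom.mulLeft (n : R)))
        (fun m hm => (QuotientAddGroup.eq_zero_iff _).2 (hN n m hm))
      map_zero' := by
        ext x
        obtain ⟨x, rfl⟩ := Submodule.Quotient.mk_surjective M x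
        change ((((0 : N) : R) * x : R) : R ⧸ aM) = 0
        simp
      map_add' := by
        intro n n'
        ext x
        obtain ⟨x, rfl⟩ := Submodule.Quotient.mk_surjective M x
        change ((((n + n' : N) : R) * x : R) : R ⧸ aM) =
          (((n : R) * x : R) : R ⧸ aM) + (((n' : R) * x : R) : R ⧸ aM)
        rw [← QuotientAddGroup.mk_add, Submodule.coe_add, add_mul] }
  let G : (N ⊗[ℤ] (R ⧸ M)) →ₗ[ℤ] (R ⧸ aM) :=
    (TensorProduct.liftAddHom g (by intro r n x; simp)).toIntLinearMap
  have hG : balancedRelations R N (R ⧸ M) ≤ LinearMap.ker G := by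
    refine Submodule.span_le.2 ?_
    rintro _ ⟨n, r, x, rfl⟩
    obtain ⟨x, rfl⟩ := Submodule.Quotient.mk_surjective M x
    rw [SetLike.mem_coe, LinearMap.mem_ker, map_sub, sub_eq_zero]
    change (((n : R) * r * x : R) : R ⧸ aM) = (((n : R) * (r * x) : R) : R ⧸ aM)
    rw [mul_assoc]
  have h := hG hzero
  rw [LinearMap.mem_ker] at h
  have h' : ((a * 1 : R) : R ⧸ aM) = 0 := h
  rw [QuotientAddGroup.eq_zero_iff, mul_one] at h'
  obtain ⟨b, hb, hab⟩ := h'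
  exact ⟨b, hb, hab.symm⟩

end Flat

/-! ### The ring modulo its Jacobson radical -/

section ModuloJacobson

variable {R : Type u} [Ring R]

theorem IsNJSymmetric.mem_jacobson_of_isNilpotent (hNJ : IsNJSymmetric R) {a : R}
    (ha : IsNilpotent a) : a ∈ Ring.jacobson R := by
  simpa using hNJ a 1 1 (by simpa using ha)

theorem isUnit_of_sub_one_mem_jacobson {y : R} (hy : y - 1 ∈ Ring.jacobson R) : IsUnit y := by
  have hleft : ∀ z : R, z - 1 ∈ Ring.jacobson R → ∃ u, u * z = 1 := by
    intro z hz
    rw [← Ideal.mem_span_singleton', ← Ideal.eq_top_iff_one]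
    by_contra hne
    obtain ⟨M, hM, hle⟩ := Ideal.exists_le_maximal _ hne
    rw [Ring.jacobson_eq_sInf_isMaximal, Submodule.mem_sInf] at hz
    exact hM.ne_top ((Ideal.eq_top_iff_one M).2 (by
      simpa using sub_mem (hle (Ideal.mem_span_singleton_self z)) (hz M hM)))
  obtain ⟨u, hu⟩ := hleft y hy
  -- The left inverse `u` is again `1` modulo the radical, so it is left invertible as well.
  obtain ⟨v, hv⟩ := hleft u (by
    have : u - 1 = -(u * (y - 1)) := by rw [mul_sub, hu, mul_one, neg_sub]
    rw [this]
    exact neg_mem (Ideal.mul_mem_left _ _ hy))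
  have hvy : v = y := left_inv_eq_right_inv hv hu
  exact ⟨⟨y, u, hvy ▸ hv, hu⟩, rfl⟩

theorem mem_jacobson_of_mem_center_of_sq_mem {a : R} (hc : a ∈ Subring.center R)
    (ha : a ^ 2 ∈ Ring.jacobson R) : a ∈ Ring.jacobson R := by
  rw [Ring.jacobson_eq_sInf_isMaximal, Submodule.mem_sInf] at ha ⊢
  intro M hM
  by_contra haM
  obtain ⟨r, m, hm, h⟩ := hM.exists_inv haM
  apply haM
  have : a = a * m + r * a ^ 2 := by
    have h1 : a * (r * a) = r * a ^ 2 := by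
      rw [← mul_assoc, ← (Subring.mem_center_iff.1 hc r), sq, mul_assoc]
    rw [← h1, ← mul_add, add_comm, h, mul_one]
  rw [this]
  exact add_mem (Ideal.mul_mem_left M _ hm) (Ideal.mul_mem_left M _ (ha M hM))

theorem one_sub_pow_of_sq_eq_zero {S : Type*} [Ring S] {a : S} (ha : a ^ 2 = 0) (n : ℕ) :
    (1 - a) ^ n = 1 - n * a := by
  induction n with
  | zero => simp
  | succ n ih =>
    rw [pow_succ, ih]
    have : (n : S) * a * a = 0 := by rw [mul_assoc, ← sq, ha, mul_zero]
    rw [mul_sub, mul_one, sub_mul, this, sub_zero, one_mul, Nat.cast_succ, add_mul, one_mul,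
      sub_sub]

/-- Expanding `(a - 1) ^ n = ± (1 - n a)`, the opposite parities of `p` and `q` give
`2 = (p + q) a`. Multiplying by `a` yields `2 a = 0`, and `p + q` is odd. -/
theorem eq_two_of_sq_eq_zero_of_pow_eq_pow {S : Type*} [Ring S] {a : S} (ha : a ^ 2 = 0)
    {p q : ℕ} (hpq : (Even p ∧ Odd q) ∨ (Odd p ∧ Even q)) (h : (a - 1) ^ q = (a - 1) ^ p) :
    a = 2 := by
  have key : 2 = ((p + q : ℕ) : S) * a := by
    rw [← neg_sub 1 a, neg_pow _ q, neg_pow _ p, one_sub_pow_of_sq_eq_zero ha,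
      one_sub_pow_of_sq_eq_zero ha] at h
    rcases hpq with ⟨hp, hq⟩ | ⟨hp, hq⟩
    · rw [hp.neg_one_pow, hq.neg_one_pow] at h
      have : (2 : S) = (p + q : ℕ) * a - (-1 * (1 - q * a) - 1 * (1 - p * a)) := by
        rw [← one_add_one_eq_two]
        push_cast
        noncomm_ring
      rw [this, h, sub_self, sub_zero]
    · rw [hp.neg_one_pow, hq.neg_one_pow] at h
      have : (2 : S) = (p + q : ℕ) * a + (1 * (1 - q * a) - -1 * (1 - p * a)) := by
        rw [← one_add_one_eq_two]
        push_cast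
        noncomm_ring
      rw [this, h, sub_self, add_zero]
  have h2 : 2 * a = 0 := by rw [key, mul_assoc, ← sq, ha, mul_zero]
  have hodd : Odd (p + q) := by
    rcases hpq with ⟨hp, hq⟩ | ⟨hp, hq⟩
    · exact hp.add_odd hq
    · exact hp.add_even hq
  obtain ⟨k, hk⟩ := hodd
  rw [key, hk]
  push_cast
  rw [add_mul, one_mul, (Nat.cast_commute k (2 : S)).symm.eq, mul_assoc, h2, mul_zero, zero_add]

/-- `R ⧸ J(R)` is reduced. If `a` squares to zero modulo the radical, semiperiodicity of the unit
`a - 1` forces `a = 2` modulo the radical, and `2` is central. -/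
theorem IsSemiperiodic.mem_jacobson_of_sq_mem (hsp : IsSemiperiodic R)
    (hN : ∀ a : R, IsNilpotent a → a ∈ Ring.jacobson R) {a : R}
    (ha : a ^ 2 ∈ Ring.jacobson R) : a ∈ Ring.jacobson R := by
  by_cases hc : a ∈ Subring.center R
  · exact mem_jacobson_of_mem_center_of_sq_mem hc ha
  by_cases hJ : a - 1 ∈ Ring.jacobson R
  · have : a = a ^ 2 - a * (a - 1) := by noncomm_ring
    rw [this]
    exact sub_mem ha (Ideal.mul_mem_left _ _ hJ)
  have hc' : a - 1 ∉ Subring.center R := fun h => hc (by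
    simpa using add_mem h (one_mem (Subring.center R)))
  obtain ⟨p, q, -, -, hpq, hnil⟩ := hsp _ hJ hc'
  have ha2 : a - 2 ∈ Ring.jacobson R := by
    rw [← Ideal.Quotient.mk_eq_mk_iff_sub_mem, map_ofNat]
    refine eq_two_of_sq_eq_zero_of_pow_eq_pow (p := p) (q := q) ?_ hpq ?_
    · rw [← map_pow, Ideal.Quotient.eq_zero_iff_mem]
      exact ha
    · rw [← map_one (Ideal.Quotient.mk (Ring.jacobson R)), ← map_sub, ← map_pow, ← map_pow,
        Ideal.Quotient.mk_eq_mk_iff_sub_mem]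
      exact hN _ hnil
  have h4 : (2 : R) ^ 2 ∈ Ring.jacobson R := by
    have : (2 : R) ^ 2 = a ^ 2 - (a * (a - 2) + (a - 2) * 2) := by
      rw [mul_sub, sub_mul, sub_add_sub_cancel, sq, sq, sub_sub_cancel]
    rw [this]
    exact sub_mem ha (add_mem (Ideal.mul_mem_left _ _ ha2) (Ideal.mul_mem_right _ _ ha2))
  have h2 : (2 : R) ∈ Ring.jacobson R :=
    mem_jacobson_of_mem_center_of_sq_mem (ofNat_mem _ 2) h4
  simpa using add_mem ha2 h2

variable {J : Ideal R} [J.IsTwoSided]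

/-- A quotient ring `R ⧸ J` without nonzero square-zero elements has the property that `x y = 0`
implies `x R y = 0`. -/
theorem mul_mul_mem_of_mul_mem (hred : ∀ a : R, a ^ 2 ∈ J → a ∈ J) {x y : R} (h : x * y ∈ J)
    (r : R) : x * r * y ∈ J := by
  have hyx : y * x ∈ J := hred _ (by
    have : (y * x) ^ 2 = y * (x * y) * x := by noncomm_ring
    rw [this]
    exact J.mul_mem_right _ (J.mul_mem_left _ h))
  refine hred _ ?_
  have : (x * r * y) ^ 2 = x * r * (y * x) * (r * y) := by noncomm_ring
  rw [this]
  exact J.mul_mem_right _ (J.mul_mem_left _ hyx)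

/-- If `R ⧸ J` is reduced, then it is von Neumann regular: the right annihilator `K` of `a` modulo
`J` is a two-sided ideal, and no maximal left ideal contains both `a` and `K`. -/
theorem IsLeftSF.exists_sub_mem (hSF : IsLeftSF R) (hred : ∀ a : R, a ^ 2 ∈ J → a ∈ J) (a : R) :
    ∃ x, a - a * x * a ∈ J := by
  let K : Ideal R :=
    { carrier := {y | a * y ∈ J}
      add_mem' := fun {x y} hx hy => by
        simpa [mul_add] using J.add_mem hx hy
      zero_mem' := by simp
      smul_mem' := fun r y hy => by
        simpa [mul_assoc] using mul_mul_mem_of_mul_mem hred hy r }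
  have htop : Ideal.span {a} ⊔ K = ⊤ := by
    by_contra hne
    obtain ⟨M, hM, hle⟩ := Ideal.exists_le_maximal _ hne
    have haM : a ∈ M := hle (Submodule.mem_sup_left (Ideal.mem_span_singleton_self a))
    obtain ⟨b, hb, hab⟩ := hSF.exists_mem_eq_mul hM haM
    have h1 : 1 - b ∈ K := by
      change a * (1 - b) ∈ J
      rw [mul_sub, mul_one, ← hab, sub_self]
      exact J.zero_mem
    have h1M : 1 - b ∈ M := hle (Submodule.mem_sup_right h1)
    exact hM.ne_top ((Ideal.eq_top_iff_one M).2 (by simpa using add_mem h1M hb))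
  obtain ⟨y, hy, z, hz, hyz⟩ := Submodule.mem_sup.1 ((Ideal.eq_top_iff_one _).1 htop)
  obtain ⟨x, rfl⟩ := Ideal.mem_span_singleton'.1 hy
  refine ⟨x, ?_⟩
  have : a - a * x * a = a * z := by
    rw [← eq_sub_iff_add_eq'] at hyz
    rw [hyz]
    noncomm_ring
  rw [this]
  exact hz

/-- In a reduced von Neumann regular ring every left ideal is two-sided. With `e = x m`, an
idempotent modulo `J`, `e r (1 - e) ∈ J`, so `m r` agrees with `m r e ∈ R m` modulo `J`. -/
theorem isTwoSided_of_le (hred : ∀ a : R, a ^ 2 ∈ J → a ∈ J)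
    (hreg : ∀ a : R, ∃ x, a - a * x * a ∈ J) {M : Ideal R} (hJM : J ≤ M) : M.IsTwoSided := by
  refine ⟨fun {m} r hm => ?_⟩
  obtain ⟨x, hx⟩ := hreg m
  have h1 : x * m * (1 - x * m) ∈ J := by
    have : x * m * (1 - x * m) = x * (m - m * x * m) := by noncomm_ring
    rw [this]
    exact J.mul_mem_left _ hx
  have h2 := mul_mul_mem_of_mul_mem hred h1 r
  have : m * r = (m - m * x * m) * r + m * (x * m * r * (1 - x * m)) + m * x * m * r * x * m := by
    noncomm_ring
  rw [this]
  exact M.add_mem (M.add_mem (hJM (J.mul_mem_right _ hx)) (hJM (J.mul_mem_left _ h2)))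
    (M.mul_mem_left _ hm)

/-- For `a ∈ J(R)`, every maximal left ideal contains `a` but, by
`IsLeftSF.exists_mem_eq_mul`, not the whole right annihilator of `a`. Modulo the radical that
annihilator is a left ideal, hence it contains an element congruent to `1`, which is a unit. -/
theorem IsLeftSF.jacobson_eq_bot (hSF : IsLeftSF R)
    (hred : ∀ a : R, a ^ 2 ∈ Ring.jacobson R → a ∈ Ring.jacobson R) : Ring.jacobson R = ⊥ := by
  rw [eq_bot_iff]
  intro a ha
  -- `T` is the right annihilator of `a` plus the radical.
  let T : Ideal R :=
    { carrier := {t | ∃ y, a * y = 0 ∧ t - y ∈ Ring.jacobson R}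
      add_mem' := by
        rintro s t ⟨y, hy, hs⟩ ⟨z, hz, ht⟩
        exact ⟨y + z, by rw [mul_add, hy, hz, add_zero],
          by simpa [add_sub_add_comm] using add_mem hs ht⟩
      zero_mem' := ⟨0, by simp, by simp⟩
      smul_mem' := by
        rintro r t ⟨y, hy, ht⟩
        obtain ⟨x, hx⟩ := hSF.exists_sub_mem hred y
        -- As `(1 - y x) y` is in the radical, so is `(1 - y x) r y`. Hence `r y` agrees modulo the
        -- radical with `y x r y`, which is annihilated by `a`.
        refine ⟨y * x * r * y, by simp [← mul_assoc, hy], ?_⟩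
        have h1 : (1 - y * x) * y ∈ Ring.jacobson R := by
          simpa [sub_mul] using hx
        have h2 := mul_mul_mem_of_mul_mem hred h1 r
        have : r • t - y * x * r * y = r * (t - y) + (1 - y * x) * r * y := by
          rw [smul_eq_mul]
          noncomm_ring
        rw [this]
        exact add_mem (Ideal.mul_mem_left _ _ ht) h2 }
  have htop : T = ⊤ := by
    by_contra hne
    obtain ⟨M, hM, hle⟩ := Ideal.exists_le_maximal _ hne
    have haM : a ∈ M := by
      rw [Ring.jacobson_eq_sInf_isMaximal, Submodule.mem_sInf] at ha
      exact ha M hM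
    obtain ⟨b, hb, hab⟩ := hSF.exists_mem_eq_mul hM haM
    have h1M : 1 - b ∈ M := hle ⟨1 - b, by rw [mul_sub, mul_one, ← hab, sub_self], by simp⟩
    exact hM.ne_top ((Ideal.eq_top_iff_one M).2 (by simpa using add_mem h1M hb))
  obtain ⟨y, hy, h1⟩ : (1 : R) ∈ T := by rw [htop]; trivial
  have hunit : IsUnit y := isUnit_of_sub_one_mem_jacobson (by simpa using neg_mem h1)
  simpa using hunit.mul_left_eq_zero.1 hy

end ModuloJacobson

/-! ### Domains with power identities of opposite parity -/

section Domain

variable {D : Type*} [Ring D] [IsDomain D]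

theorem exists_odd_pow_eq_one {d : D} (hd : d ≠ 0) {p q : ℕ}
    (hpq : (Even p ∧ Odd q) ∨ (Odd p ∧ Even q)) (h : d ^ q = d ^ p) : ∃ m, Odd m ∧ d ^ m = 1 := by
  wlog hle : p ≤ q generalizing p q
  · exact this (p := q) (q := p) (by tauto) h.symm (by omega)
  refine ⟨q - p, by grind, ?_⟩
  have h1 : d ^ p * d ^ (q - p) = d ^ p * 1 := by rw [← pow_add, mul_one, ← h]; congr 1; omega
  exact mul_left_cancel₀ (pow_ne_zero _ hd) h1

/-- Conjugation by `a` has odd order `N`, so in characteristic two it can be diagonalized with the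
powers of `a` as eigenvalues: `y` is the sum of the eigenvectors
`∑ j < N, (a ^ i) ^ j * y * a ^ (-j)` for `i < N`. If `y` does not commute with `a`, one of these
does not either. -/
theorem exists_pow_mul_eq_mul_of_odd_orderOf [CharP D 2] {a y : D} (ha : Odd (orderOf a))
    (hay : a * y ≠ y * a) : ∃ (i : ℕ) (w : D), w * a = a ^ i * w ∧ a * w ≠ w * a := by
  set N := orderOf a with hN
  have haN : a ^ N = 1 := pow_orderOf_eq_one a
  have hpos : 0 < N := ha.pos
  let b := a ^ (N - 1)
  have hba : b * a = 1 := by rw [← pow_succ, Nat.sub_add_cancel hpos, haN]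
  have hbN : b ^ N = 1 := by rw [← pow_mul, mul_comm, pow_mul, haN, one_pow]
  let e : ℕ → D := fun i => ∑ j ∈ Finset.range N, (a ^ i) ^ j * y * b ^ j
  have he : ∀ i, e i * a = a ^ i * e i := by
    intro i
    have h1 : a ^ i * e i * b = e i := by
      have hs : ∀ f : ℕ → D, f N = f 0 →
          ∑ j ∈ Finset.range N, f (j + 1) = ∑ j ∈ Finset.range N, f j := by
        intro f hf
        have h2 := Finset.sum_range_succ f N
        rw [Finset.sum_range_succ', hf] at h2
        exact add_right_cancel h2
      change a ^ i * (∑ j ∈ Finset.range N, (a ^ i) ^ j * y * b ^ j) * b =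
        ∑ j ∈ Finset.range N, (a ^ i) ^ j * y * b ^ j
      rw [Finset.mul_sum, Finset.sum_mul]
      refine Eq.trans ?_ (hs (fun j => (a ^ i) ^ j * y * b ^ j) ?_)
      · refine Finset.sum_congr rfl fun j _ => ?_
        change a ^ i * ((a ^ i) ^ j * y * b ^ j) * b = (a ^ i) ^ (j + 1) * y * b ^ (j + 1)
        rw [pow_succ' (a ^ i), pow_succ b]
        simp only [mul_assoc]
      · simp only [pow_zero, hbN, ← pow_mul, mul_comm i N]
        rw [pow_mul, haN, one_pow]
    calc e i * a = a ^ i * e i * b * a := by rw [h1]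
      _ = a ^ i * e i := by rw [mul_assoc, hba, mul_one]
  -- The coefficient of `a ^ j * y * a ^ (-j)` in the sum is `∑ i < N, (a ^ j) ^ i`, which is zero
  -- for `0 < j < N` and is `N = 1` for `j = 0`.
  have hsum : ∑ i ∈ Finset.range N, e i = y := by
    rw [Finset.sum_comm]
    have h0 : ∀ j ∈ Finset.range N, j ≠ 0 →
        ∑ i ∈ Finset.range N, (a ^ i) ^ j * y * b ^ j = 0 := by
      intro j hj hj0
      have hgeom : ∑ i ∈ Finset.range N, (a ^ j) ^ i = 0 := by
        have h1 : a ^ j - 1 ≠ 0 := sub_ne_zero.2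
          (pow_ne_one_of_lt_orderOf hj0 (Finset.mem_range.1 hj))
        have h2 := geom_sum_mul (a ^ j) N
        rw [← pow_mul, mul_comm j N, pow_mul, haN, one_pow, sub_self] at h2
        exact (mul_eq_zero.1 h2).resolve_right h1
      simp only [← Finset.sum_mul, ← pow_mul, mul_comm _ j] at hgeom ⊢
      rw [hgeom, zero_mul, zero_mul]
    rw [Finset.sum_eq_single_of_mem 0 (Finset.mem_range.2 hpos) h0]
    obtain ⟨k, hk⟩ := ha
    have h2 : (2 : D) = 0 := CharTwo.two_eq_zero
    simp [hk, h2]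
  by_contra! hcon
  refine hay ?_
  rw [← hsum, Finset.mul_sum, Finset.sum_mul]
  exact Finset.sum_congr rfl fun i _ => hcon i (e i) (he i)

theorem finite_adjoin_of_finite_submonoid {K A : Type*} [Field K] [Finite K] [Ring A]
    [Algebra K A] {S : Submonoid A} (hS : (S : Set A).Finite) :
    Finite (Algebra.adjoin K (S : Set A)) := by
  have hspan := Algebra.adjoin_eq_span K (S : Set A)
  rw [Submonoid.closure_eq] at hspan
  have : Module.Finite K (Submodule.span K (S : Set A)) :=
    Module.Finite.span_of_finite K hS
  have : Finite (Submodule.span K (S : Set A)) := Module.finite_of_finite K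
  rw [← hspan] at this
  exact this

/-- The products `a ^ k * w ^ l` form a finite monoid, whose linear span over the field with two
elements is a finite domain, commutative by Wedderburn's theorem. -/
theorem commute_of_mul_eq_pow_mul [CharP D 2] {a w : D} (ha : IsOfFinOrder a)
    (hw : IsOfFinOrder w) {i : ℕ} (h : w * a = a ^ i * w) : a * w = w * a := by
  let _ : Algebra (ZMod 2) D := ZMod.algebra D 2
  have h1 : ∀ k, w * a ^ k = a ^ (i * k) * w := by
    intro k
    rw [pow_mul]
    exact (show SemiconjBy w a (a ^ i) from h).pow_right k
  have h2 : ∀ l k, w ^ l * a ^ k = a ^ (i ^ l * k) * w ^ l := by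
    intro l
    induction l with
    | zero => simp
    | succ l ih =>
      intro k
      rw [pow_succ, mul_assoc, h1, ← mul_assoc, ih, mul_assoc]
      congr 2
      ring
  let S : Submonoid D :=
    { carrier := Set.image2 (· * ·) (Submonoid.powers a) (Submonoid.powers w)
      one_mem' := ⟨1, one_mem _, 1, one_mem _, mul_one 1⟩
      mul_mem' := by
        rintro _ _ ⟨_, ⟨k, rfl⟩, _, ⟨l, rfl⟩, rfl⟩ ⟨_, ⟨k', rfl⟩, _, ⟨l', rfl⟩, rfl⟩
        refine ⟨a ^ (k + i ^ l * k'), ⟨_, rfl⟩, w ^ (l + l'), ⟨_, rfl⟩, ?_⟩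
        change a ^ (k + i ^ l * k') * w ^ (l + l') = a ^ k * w ^ l * (a ^ k' * w ^ l')
        rw [pow_add, pow_add, mul_assoc, mul_assoc, ← mul_assoc (w ^ l), h2]
        simp only [mul_assoc] }
  have hfin : (S : Set D).Finite :=
    Set.Finite.image2 _ ha.finite_powers hw.finite_powers
  let A := Algebra.adjoin (ZMod 2) (S : Set D)
  have hA : Finite A := finite_adjoin_of_finite_submonoid hfin
  have haA : a ∈ A := Algebra.subset_adjoin
    ⟨a, Submonoid.mem_powers a, 1, one_mem _, mul_one a⟩
  have hwA : w ∈ A := Algebra.subset_adjoin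
    ⟨1, one_mem _, w, Submonoid.mem_powers w, one_mul w⟩
  have := (Finite.isDomain_to_isField A).mul_comm ⟨a, haA⟩ ⟨w, hwA⟩
  exact congrArg Subtype.val this

/-- For noncentral `a`, both `a` and `-a` have odd order, so `1 = -1` and the eigenvector argument
in characteristic two applies. -/
theorem mul_comm_of_mem_center_or_pow_eq_pow
    (h : ∀ d : D, d ∈ Subring.center D ∨
      ∃ p q : ℕ, ((Even p ∧ Odd q) ∨ (Odd p ∧ Even q)) ∧ d ^ q = d ^ p) (a b : D) :
    a * b = b * a := by
  have hper : ∀ d : D, d ∉ Subring.center D → ∃ m, Odd m ∧ d ^ m = 1 := by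
    intro d hd
    obtain ⟨p, q, hpq, hdpq⟩ := (h d).resolve_left hd
    exact exists_odd_pow_eq_one (fun h0 => hd (h0 ▸ zero_mem _)) hpq hdpq
  have hfin : ∀ d : D, d ∉ Subring.center D → IsOfFinOrder d := fun d hd => by
    obtain ⟨m, hm, hdm⟩ := hper d hd
    exact isOfFinOrder_iff_pow_eq_one.2 ⟨m, hm.pos, hdm⟩
  by_contra hab
  have ha : a ∉ Subring.center D := fun hc => hab (Subring.mem_center_iff.1 hc b).symm
  obtain ⟨m, hm, ham⟩ := hper a ha
  obtain ⟨n, hn, han⟩ := hper (-a) (by simpa using ha)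
  have h2 : (2 : D) = 0 := by
    have h1 : (-a) ^ (m * n) = 1 := by rw [mul_comm, pow_mul, han, one_pow]
    rw [(hm.mul hn).neg_pow, pow_mul, ham, one_pow] at h1
    rw [← one_add_one_eq_two, ← neg_eq_iff_add_eq_zero, h1]
  have : CharP D 2 := CharTwo.of_one_ne_zero_of_two_eq_zero one_ne_zero h2
  obtain ⟨i, w, hw, hne⟩ := exists_pow_mul_eq_mul_of_odd_orderOf
    (Odd.of_dvd_nat hm (orderOf_dvd_of_pow_eq_one ham)) hab
  exact hne (commute_of_mul_eq_pow_mul (hfin a ha)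
    (hfin w fun hc => hne (Subring.mem_center_iff.1 hc a)) hw)

end Domain

/-! ### Quotients by maximal left ideals -/

theorem isDomain_quotient_of_isMaximal_of_isTwoSided {R : Type u} [Ring R] {M : Ideal R}
    (hM : M.IsMaximal) [M.IsTwoSided] : IsDomain (R ⧸ M) := by
  have : Nontrivial (R ⧸ M) := Ideal.Quotient.nontrivial_iff.2 hM.ne_top
  have : NoZeroDivisors (R ⧸ M) := by
    refine ⟨fun {x y} hxy => ?_⟩
    obtain ⟨x, rfl⟩ := Ideal.Quotient.mk_surjective x
    obtain ⟨y, rfl⟩ := Ideal.Quotient.mk_surjective y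
    rw [← map_mul] at hxy
    rw [Ideal.Quotient.eq_zero_iff_mem] at hxy ⊢
    rw [Ideal.Quotient.eq_zero_iff_mem]
    by_contra! hcon
    obtain ⟨r, m, hm, h⟩ := hM.exists_inv hcon.1
    have : y = r * (x * y) + m * y := by rw [← mul_assoc, ← add_mul, h, one_mul]
    apply hcon.2
    rw [this]
    exact M.add_mem (M.mul_mem_left _ hxy) (M.mul_mem_right _ hm)
  exact NoZeroDivisors.to_isDomain _

end RingNotions

theorem mainTheorem6 (R : Type u) [Ring R]
    (hNJ : RingNotions.IsNJSymmetric R)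
    (hSF : RingNotions.IsLeftSF R)
    (hsp : RingNotions.IsSemiperiodic R) :
    (∀ a b : R, a * b = b * a) ∧ RingNotions.IsVonNeumannRegular R := by
  have hN : ∀ a : R, IsNilpotent a → a ∈ Ring.jacobson R := fun a ha =>
    hNJ.mem_jacobson_of_isNilpotent ha
  have hred : ∀ a : R, a ^ 2 ∈ Ring.jacobson R → a ∈ Ring.jacobson R := fun a ha =>
    hsp.mem_jacobson_of_sq_mem hN ha
  have hreg := hSF.exists_sub_mem hred
  have hJ := hSF.jacobson_eq_bot hred
  refine ⟨fun a b => ?_, fun a => ?_⟩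
  · rw [← sub_eq_zero, ← Ideal.mem_bot, ← hJ, Ring.jacobson_eq_sInf_isMaximal,
      Submodule.mem_sInf]
    intro M hM
    have : Ideal.IsTwoSided M := RingNotions.isTwoSided_of_le hred hreg (by rw [hJ]; exact bot_le)
    have := RingNotions.isDomain_quotient_of_isMaximal_of_isTwoSided hM
    rw [← Ideal.Quotient.mk_eq_mk_iff_sub_mem, map_mul, map_mul]
    refine RingNotions.mul_comm_of_mem_center_or_pow_eq_pow (fun d => ?_) _ _
    obtain ⟨r, rfl⟩ := Ideal.Quotient.mk_surjective d
    by_cases hc : r ∈ Subring.center R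
    · left
      rw [Subring.mem_center_iff]
      intro s
      obtain ⟨s, rfl⟩ := Ideal.Quotient.mk_surjective s
      rw [← map_mul, ← map_mul, Subring.mem_center_iff.1 hc s]
    · right
      have hr : r ∉ Ring.jacobson R := by
        rw [hJ, Ideal.mem_bot]
        rintro rfl
        exact hc (zero_mem _)
      obtain ⟨p, q, -, -, hpq, hnil⟩ := hsp r hr hc
      refine ⟨p, q, hpq, ?_⟩
      have h0 := hN _ hnil
      rw [hJ, Ideal.mem_bot, sub_eq_zero] at h0
      rw [← map_pow, ← map_pow, h0]
  · obtain ⟨x, hx⟩ := hreg a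
    rw [hJ, Ideal.mem_bot, sub_eq_zero] at hx
    exact ⟨x, hx⟩
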